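/- Call a group $G$ \emph{integrable} if there is a group $H$ whose derived (commutator) subgroup $H'$ is isomorphic to $G$. Let $n$ be a positive integer. Then every group of order $n$ is integrable if and only if $n$ is cube-free (that is, not divisible by the cube of any prime) and there do not exist prime divisors $p$, $q$ of $n$ with $q \mid p-1$. -/

import Mathlib

universe u

/-- `H` is an integral of `G`: the derived (commutator) subgroup of `H` is isomorphic to `G`. -/
def IsGroupIntegral (G : Type*) [Group G] (H : Type*) [Group H] : Prop :=
  Nonempty (commutator H ≃* G)

/-- `G` is integrable: some group `H` (finite or infinite) is an integral of `G`. -/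
def IsGroupIntegrable (G : Type u) [Group G] : Prop :=
  ∃ (H : Type u) (_ : Group H), IsGroupIntegral G H

/-- `n` is cube-free: it is not divisible by the cube of any prime. -/
def Nat.IsCubeFree (n : ℕ) : Prop :=
  ∀ p : ℕ, p.Prime → ¬ p ^ 3 ∣ n

/-! Identify `G` with `H'`. Conjugation maps `H` onto a group `A` of automorphisms of `G` with `A' =
Inn G`. If `A` acts commutatively on some `a`, for instance by powers of `a`, then `Inn G` fixes
`a`, so `a` is central. Necessity comes from groups that have a noncentral such element for every
candidate `A`: if `q ∣ p - 1`, a cyclic normal Sylow `p`-subgroup acted on by an element of order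
`q`; if `p ^ 3 ∣ n`, a dihedral group for `p = 2` and `SkewExtension` for odd `p`.

For sufficiency, an even `n` must be 2 or 4, since 2 divides `q - 1` for every odd prime `q`; then
`G` is abelian, and `ShearGroup` is an integral of any abelian group. For odd `n` it is enough to
find an automorphism `σ` inverting the abelianization of `G`: then `G ⋊ ⟨σ⟩` is an integral.
Burnside transfer gives a normal Sylow subgroup `P`, so `G = P ⋊ K` with `P` abelian of order
dividing `p ^ 2`. The image of `K` in `Aut P` is trivial or acts irreducibly, inside the
multiplicative group of a finite field, and Frobenius inverts it. Frobenius (or inversion, if the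
action is trivial) extends an inverting automorphism of `K` to `G`, by induction on the order. -/

open scoped commutatorElement

/-! ### Obstructions from the action on the derived subgroup -/

/-- If `G` is integrable, some group of automorphisms of `G` has the inner automorphism group as its
derived subgroup. -/
theorem IsGroupIntegral.exists_commutator_eq_inner {G H : Type*} [Group G] [Group H]
    (h : IsGroupIntegral G H) :
    ∃ A : Subgroup (MulAut G), ⁅A, A⁆ = (MulAut.conj : G →* MulAut G).range := by
  obtain ⟨e⟩ := h
  let Φ : H →* MulAut G := (MulAut.congr e).toMonoidHom.comp MulAut.conjNormal
  have hΦ : Φ.comp (commutator H).subtype = MulAut.conj.comp e.toMonoidHom := by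
    ext x g
    simp only [Φ, MonoidHom.comp_apply, MulEquiv.coe_toMonoidHom, Subgroup.coe_subtype,
      MulAut.congr_apply, MulEquiv.trans_apply, MulAut.conj_apply]
    obtain ⟨y, rfl⟩ := e.surjective g
    rw [← map_inv, ← map_mul, ← map_mul, MulEquiv.symm_apply_apply]
    congr 1
  refine ⟨Φ.range, ?_⟩
  rw [MonoidHom.range_eq_map, ← Subgroup.map_commutator, ← commutator_def,
    ← Subgroup.range_subtype (commutator H), MonoidHom.map_range, hΦ, MonoidHom.range_comp,
    MonoidHom.range_eq_top.mpr e.surjective, ← MonoidHom.range_eq_map]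

/-- An element on which the automorphisms in `A` commute is central, if the derived subgroup of `A`
contains the inner automorphisms. -/
theorem mem_center_of_commuting_action {G : Type*} [Group G] {A : Subgroup (MulAut G)}
    (hA : ⁅A, A⁆ = (MulAut.conj : G →* MulAut G).range) {a : G}
    (ha : ∀ φ ∈ A, ∀ ψ ∈ A, φ (ψ a) = ψ (φ a)) : a ∈ Subgroup.center G := by
  have h : ⁅A, A⁆ ≤ MulAction.stabilizer (MulAut G) a := by
    rw [Subgroup.commutator_le]
    intro φ hφ ψ hψ
    have := ha _ (A.inv_mem hφ) _ (A.inv_mem hψ)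
    rw [MulAction.mem_stabilizer_iff, commutatorElement_def, MulAut.smul_def]
    simp only [MulAut.mul_apply, this, MulAut.apply_inv_self]
  rw [hA] at h
  rw [Subgroup.mem_center_iff]
  intro g
  have := h ⟨g, rfl⟩
  rw [MulAction.mem_stabilizer_iff, MulAut.smul_def, MulAut.conj_apply] at this
  exact mul_inv_eq_iff_eq_mul.mp this

/-- An element sent to a power of itself by all automorphisms in `A` is central, if the derived
subgroup of `A` contains the inner automorphisms. -/
theorem mem_center_of_forall_exists_pow {G : Type*} [Group G] {A : Subgroup (MulAut G)}
    (hA : ⁅A, A⁆ = (MulAut.conj : G →* MulAut G).range) {a : G}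
    (ha : ∀ φ ∈ A, ∃ i : ℕ, φ a = a ^ i) : a ∈ Subgroup.center G := by
  refine mem_center_of_commuting_action hA fun φ hφ ψ hψ => ?_
  obtain ⟨i, hi⟩ := ha φ hφ
  obtain ⟨j, hj⟩ := ha ψ hψ
  rw [hi, hj, map_pow, map_pow, hi, hj, ← pow_mul, ← pow_mul, mul_comm]

/-! ### Dihedral groups and cyclic normal Sylow subgroups -/

theorem DihedralGroup.not_isGroupIntegral {k : ℕ} (hk : 2 < k) (H : Type*) [Group H] :
    ¬ IsGroupIntegral (DihedralGroup k) H := by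
  intro h
  obtain ⟨A, hA⟩ := h.exists_commutator_eq_inner
  have h2 : (2 : ZMod k) ≠ 0 := by
    intro h
    have := (ZMod.natCast_eq_zero_iff 2 k).mp (by exact_mod_cast h)
    exact absurd (Nat.le_of_dvd two_pos this) (by omega)
  have := mem_center_of_forall_exists_pow hA (a := DihedralGroup.r 1) fun φ _ => by
    rcases hφ : φ (DihedralGroup.r 1) with i | i
    · have : NeZero k := ⟨by omega⟩
      exact ⟨i.val, by simp⟩
    -- A reflection is an involution, while `r 1` has square `r 2 ≠ 1`.
    · have h1 : φ (DihedralGroup.r 1 * DihedralGroup.r 1) = φ 1 := by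
        rw [map_mul, hφ, DihedralGroup.sr_mul_self, map_one]
      rw [φ.injective.eq_iff, DihedralGroup.r_mul_r, DihedralGroup.one_def,
        DihedralGroup.r.injEq, one_add_one_eq_two] at h1
      exact absurd h1 h2
  have h1 := Subgroup.mem_center_iff.mp this (DihedralGroup.sr 0)
  rw [DihedralGroup.sr_mul_r, DihedralGroup.r_mul_sr, DihedralGroup.sr.injEq] at h1
  exact h2 (by linear_combination h1)

/-- A semidirect product of a cyclic group by a group of coprime order that acts nontrivially is not
integrable. -/
theorem SemidirectProduct.not_isGroupIntegral {N K : Type*} [Group N] [Group K] [Finite N]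
    [Finite K] [IsCyclic N] (hNK : (Nat.card N).Coprime (Nat.card K)) {f : K →* MulAut N}
    (hf : f ≠ 1) (H : Type*) [Group H] : ¬ IsGroupIntegral (N ⋊[f] K) H := by
  intro h
  obtain ⟨A, hA⟩ := h.exists_commutator_eq_inner
  obtain ⟨a, ha⟩ := IsCyclic.exists_generator (α := N)
  have h1 := mem_center_of_forall_exists_pow hA (a := SemidirectProduct.inl a) fun φ _ => by
    have h1 : (φ (inl a)).right ^ Nat.card N = 1 := by
      rw [← rightHom_eq_right, ← map_pow, ← map_pow, ← map_pow, pow_card_eq_one', map_one, map_one,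
        map_one]
    -- Coprimality makes `N` characteristic, so `φ` maps the generator `a` to one of its powers.
    have h2 : (φ (inl a)).right = 1 := by
      rw [← orderOf_eq_one_iff]
      exact Nat.eq_one_of_dvd_coprimes hNK (orderOf_dvd_of_pow_eq_one h1) (orderOf_dvd_natCard _)
    obtain ⟨i, hi : a ^ i = _⟩ := mem_powers_iff_mem_zpowers.mpr (ha (φ (inl a)).left)
    refine ⟨i, ?_⟩
    rw [← map_pow, hi]
    ext <;> simp [h2]
  refine hf (MonoidHom.ext fun k => MulEquiv.ext fun x => ?_)
  have h2 : f k a = a := by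
    have := Subgroup.mem_center_iff.mp h1 (inr k)
    simpa using congr_arg SemidirectProduct.left this
  obtain ⟨i, rfl⟩ := ha x
  simp [h2]

theorem exists_card_eq_not_isGroupIntegral_of_dvd_sub_one {n p q : ℕ} (hn : n ≠ 0) (hp : p.Prime)
    (hq : q.Prime) (hpn : p ∣ n) (hqn : q ∣ n) (hqp : q ∣ p - 1) :
    ∃ (G : Type) (_ : Group G), Nat.card G = n ∧
      ∀ (H : Type u) [Group H], ¬ IsGroupIntegral G H := by
  have := Fact.mk hp
  have := Fact.mk hq
  obtain ⟨a, m, hpm, rfl⟩ := Nat.exists_eq_pow_mul_and_not_dvd hn p hp.ne_one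
  have ha : a ≠ 0 := by rintro rfl; simp at hpn; exact hpm hpn
  have hne : q ≠ p := by
    rintro rfl
    exact absurd (Nat.le_of_dvd (Nat.sub_pos_of_lt hp.one_lt) hqp) (by have := hp.pos; omega)
  have hqm : q ∣ m := by
    refine (hq.dvd_mul.mp hqn).resolve_left fun h => hne ?_
    exact (Nat.prime_dvd_prime_iff_eq hq hp).mp (hq.dvd_of_dvd_pow h)
  have : NeZero m := ⟨by rintro rfl; simp at hn⟩
  have : NeZero (p ^ a) := ⟨pow_ne_zero _ hp.ne_zero⟩
  let N := Multiplicative (ZMod (p ^ a))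
  let K := Multiplicative (ZMod m)
  have hN : Nat.card N = p ^ a := by simp [N]
  have hK : Nat.card K = m := by simp [K]
  have : Finite N := inferInstanceAs (Finite (Multiplicative (ZMod (p ^ a))))
  have : Finite K := inferInstanceAs (Finite (Multiplicative (ZMod m)))
  have : IsCyclic N := inferInstanceAs (IsCyclic (Multiplicative (ZMod (p ^ a))))
  have : IsCyclic K := inferInstanceAs (IsCyclic (Multiplicative (ZMod m)))
  -- Cauchy's theorem applies because `Aut N` has order `p ^ (a - 1) * (p - 1)`.
  obtain ⟨α, hα⟩ := exists_prime_orderOf_dvd_card' (G := MulAut N) q (by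
    rw [IsCyclic.card_mulAut, hN, Nat.totient_prime_pow hp (Nat.pos_of_ne_zero ha)]
    exact hqp.mul_left _)
  obtain ⟨g, hg⟩ := IsCyclic.exists_generator (α := K)
  have hord : orderOf α ∣ orderOf g := by
    rw [hα, orderOf_eq_card_of_forall_mem_zpowers hg, hK]
    exact hqm
  refine ⟨N ⋊[monoidHomOfForallMemZpowers hg hord] K, inferInstance, ?_, fun H _ => ?_⟩
  · rw [SemidirectProduct.card, hN, hK]
  · refine SemidirectProduct.not_isGroupIntegral ?_ ?_ H
    · rw [hN, hK]
      exact ((Nat.Prime.coprime_iff_not_dvd hp).mpr hpm).pow_left a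
    · intro h
      have h1 := monoidHomOfForallMemZpowers_apply_gen hg hord
      rw [h, MonoidHom.one_apply] at h1
      rw [← h1, orderOf_one] at hα
      exact hq.one_lt.ne hα

/-! ### A non-integrable group of order `p ^ 3 * k` for odd `p` -/

/-- The embedding of `ZMod p` into `ZMod (p * (p * k))`. -/
def ZMod.embedMul (p k : ℕ) : ZMod p →+ ZMod (p * (p * k)) :=
  ZMod.lift p ⟨(AddMonoidHom.mulRight ((p * k : ℕ) : ZMod (p * (p * k)))).comp
    (Int.castAddHom _), by
      simp only [AddMonoidHom.comp_apply, Int.coe_castAddHom, AddMonoidHom.mulRight_apply,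
        Int.cast_natCast]
      rw [← Nat.cast_mul, ZMod.natCast_self]⟩

/-- The reduction of `ZMod (p * (p * k))` onto `ZMod p`. -/
abbrev ZMod.reduceMul (p k : ℕ) : ZMod (p * (p * k)) →+* ZMod p :=
  ZMod.castHom (dvd_mul_right p (p * k)) (ZMod p)

theorem ZMod.embedMul_reduceMul (p k : ℕ) (x : ZMod (p * (p * k))) :
    embedMul p k (reduceMul p k x) = x * (p * k : ℕ) := by
  obtain ⟨m, rfl⟩ := ZMod.intCast_surjective x
  rw [map_intCast]
  simp [embedMul]

theorem ZMod.reduceMul_surjective (p k : ℕ) : Function.Surjective (reduceMul p k) := fun x => by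
  obtain ⟨m, rfl⟩ := ZMod.intCast_surjective x
  exact ⟨m, map_intCast _ m⟩

@[simp]
theorem ZMod.reduceMul_embedMul (p k : ℕ) (x : ZMod p) :
    reduceMul p k (embedMul p k x) = 0 := by
  obtain ⟨y, rfl⟩ := reduceMul_surjective p k x
  rw [embedMul_reduceMul, map_mul, map_natCast]
  simp

theorem ZMod.embedMul_injective {p k : ℕ} (hp : p ≠ 0) (hk : k ≠ 0) :
    Function.Injective (embedMul p k) := by
  rw [injective_iff_map_eq_zero]
  intro x hx
  obtain ⟨m, rfl⟩ := ZMod.intCast_surjective x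
  rw [← map_intCast (reduceMul p k), embedMul_reduceMul, ← Int.cast_natCast (p * k), ← Int.cast_mul,
    ZMod.intCast_zmod_eq_zero_iff_dvd _ _, Nat.cast_mul p (p * k)] at hx
  rw [ZMod.intCast_zmod_eq_zero_iff_dvd]
  exact Int.dvd_of_mul_dvd_mul_right (by positivity) hx

theorem ZMod.exists_embedMul_eq {p k : ℕ} (hp : p ≠ 0) {x : ZMod (p * (p * k))}
    (hx : (p : ZMod (p * (p * k))) * x = 0) : ∃ y, embedMul p k y = x := by
  obtain ⟨m, rfl⟩ := ZMod.intCast_surjective x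
  rw [← Int.cast_natCast p, ← Int.cast_mul, ZMod.intCast_zmod_eq_zero_iff_dvd,
    Nat.cast_mul p (p * k)] at hx
  obtain ⟨t, rfl⟩ := Int.dvd_of_mul_dvd_mul_left (by positivity) hx
  refine ⟨t, ?_⟩
  rw [← map_intCast (reduceMul p k), embedMul_reduceMul]
  push_cast
  ring

/-- The central extension of `(ZMod p) ^ 2` by `ZMod (p * k)` on the set `ZMod (p ^ 2 * k) × ZMod p`
whose multiplication is addition twisted by an alternating form. -/
@[ext]
structure SkewExtension (p k : ℕ) where
  fst : ZMod (p * (p * k))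
  snd : ZMod p

namespace SkewExtension

open ZMod

variable {p k : ℕ}

instance : Mul (SkewExtension p k) where
  mul g h := ⟨g.fst + h.fst +
    embedMul p k (g.snd * reduceMul p k h.fst - h.snd * reduceMul p k g.fst), g.snd + h.snd⟩

instance : One (SkewExtension p k) where
  one := ⟨0, 0⟩

instance : Inv (SkewExtension p k) where
  inv g := ⟨-g.fst, -g.snd⟩

theorem fst_mul (g h : SkewExtension p k) : (g * h).fst = g.fst + h.fst +
    embedMul p k (g.snd * reduceMul p k h.fst - h.snd * reduceMul p k g.fst) := rfl

@[simp]
theorem snd_mul (g h : SkewExtension p k) : (g * h).snd = g.snd + h.snd := rfl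

@[simp]
theorem fst_one : (1 : SkewExtension p k).fst = 0 := rfl

@[simp]
theorem snd_one : (1 : SkewExtension p k).snd = 0 := rfl

@[simp]
theorem fst_inv (g : SkewExtension p k) : g⁻¹.fst = -g.fst := rfl

@[simp]
theorem snd_inv (g : SkewExtension p k) : g⁻¹.snd = -g.snd := rfl

@[simp]
theorem reduceMul_fst_mul (g h : SkewExtension p k) :
    reduceMul p k (g * h).fst = reduceMul p k g.fst + reduceMul p k h.fst := by
  rw [fst_mul, map_add, reduceMul_embedMul, add_zero, map_add]

instance : Group (SkewExtension p k) :=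
  Group.ofLeftAxioms
    (fun a b c => by
      ext
      · rw [fst_mul, fst_mul a (b * c), reduceMul_fst_mul, reduceMul_fst_mul, fst_mul a b,
          fst_mul b c]
        simp only [snd_mul, mul_add, add_mul, map_add, map_sub]
        abel
      · simp only [snd_mul, add_assoc])
    (fun a => by ext <;> simp [fst_mul])
    (fun a => by ext <;> simp [fst_mul])

/-- The alternating twist vanishes on a pair of powers of one element. -/
theorem pow_eq (g : SkewExtension p k) (m : ℕ) : g ^ m = ⟨m * g.fst, m * g.snd⟩ := by
  induction m with
  | zero => ext <;> simp
  | succ m ih =>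
    rw [pow_succ, ih]
    ext
    · rw [fst_mul, map_mul, map_natCast]
      push_cast
      rw [show (m : ZMod p) * g.snd * reduceMul p k g.fst - g.snd * (m * reduceMul p k g.fst) = 0 by
        ring, map_zero]
      ring
    · push_cast [snd_mul]
      ring

/-- The underlying set of `SkewExtension p k`. -/
def equivProd (p k : ℕ) : SkewExtension p k ≃ ZMod (p * (p * k)) × ZMod p where
  toFun g := (g.fst, g.snd)
  invFun x := ⟨x.1, x.2⟩
  left_inv _ := rfl
  right_inv _ := rfl

theorem card_eq (p k : ℕ) : Nat.card (SkewExtension p k) = p ^ 3 * k := by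
  rw [Nat.card_congr (equivProd p k), Nat.card_prod, Nat.card_zmod, Nat.card_zmod]
  ring

/-- Write `a = (1, 0)`, `b = (0, 1)`, `c = (embedMul 1, 0)`, and let `l` be the first coordinate of
`φ a` mod `p`. Since `c = a ^ (p * k)`, `φ c = c ^ l`. Since `b ^ p = 1`, the first coordinate of `φ
b` is `p`-torsion, so `φ b` is a power `b ^ j` up to the centre. Applying `φ` to `b * a = c ^ 2 * (a
* b)` gives `2 * l * j = 2 * l`, and `j = 1` as `p` is odd. -/
theorem map_mk_zero_one [Fact p.Prime] (hp : p ≠ 2) (hk : k ≠ 0) (φ : MulAut (SkewExtension p k)) :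
    reduceMul p k (φ ⟨1, 0⟩).fst ≠ 0 ∧ φ ⟨embedMul p k 1, 0⟩ =
      ⟨embedMul p k (reduceMul p k (φ ⟨1, 0⟩).fst), 0⟩ ∧
      ∃ y, φ ⟨0, 1⟩ = ⟨embedMul p k y, 1⟩ := by
  have hp0 : p ≠ 0 := (Fact.out : p.Prime).ne_zero
  have hinj := embedMul_injective hp0 hk
  have h2 : (2 : ZMod p) ≠ 0 := by
    intro h
    have h := (ZMod.natCast_eq_zero_iff 2 p).mp (by exact_mod_cast h)
    exact hp ((Nat.prime_dvd_prime_iff_eq Fact.out Nat.prime_two).mp h)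
  have hz : φ ⟨embedMul p k 1, 0⟩ = ⟨embedMul p k (reduceMul p k (φ ⟨1, 0⟩).fst), 0⟩ := by
    have h1 : (⟨embedMul p k 1, 0⟩ : SkewExtension p k) = ⟨1, 0⟩ ^ (p * k) := by
      rw [pow_eq, ← map_one (reduceMul p k), embedMul_reduceMul]
      simp
    rw [h1, map_pow, pow_eq, embedMul_reduceMul, mul_comm]
    simp
  have hne : reduceMul p k (φ ⟨1, 0⟩).fst ≠ 0 := by
    intro h
    rw [h, map_zero] at hz
    have h1 := φ.injective (hz.trans (map_one φ).symm)
    have h2 := hinj ((congr_arg fst h1).trans (map_zero _).symm)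
    exact one_ne_zero h2
  have hb : ∃ y, embedMul p k y = (φ ⟨0, 1⟩).fst := by
    refine exists_embedMul_eq hp0 ?_
    have h1 : (⟨0, 1⟩ : SkewExtension p k) ^ p = 1 := by
      rw [pow_eq]
      ext <;> simp
    have h2 := congr_arg φ h1
    rw [map_pow, map_one, pow_eq] at h2
    exact congr_arg fst h2
  obtain ⟨y, hy⟩ := hb
  refine ⟨hne, hz, y, ?_⟩
  have hred : reduceMul p k (φ ⟨0, 1⟩).fst = 0 := by rw [← hy, reduceMul_embedMul]
  have hcomm : (⟨0, 1⟩ : SkewExtension p k) * ⟨1, 0⟩ = ⟨embedMul p k 1, 0⟩ ^ 2 * (⟨1, 0⟩ * ⟨0, 1⟩) := by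
    rw [pow_eq]
    ext
    · simp only [fst_mul, snd_mul, map_mul, reduceMul_embedMul, map_add]
      simp
      ring
    · simp
  have h3 := congr_arg φ hcomm
  rw [map_mul, map_mul, map_pow, map_mul, hz, pow_eq] at h3
  replace h3 := congr_arg fst h3
  simp only [fst_mul, map_mul, snd_mul, reduceMul_embedMul, map_add, hred] at h3
  set l := reduceMul p k (φ ⟨1, 0⟩).fst
  have h4 : embedMul p k (2 * l * ((φ ⟨0, 1⟩).snd - 1)) = 0 := by
    have : 2 * l * ((φ ⟨0, 1⟩).snd - 1) = (φ ⟨0, 1⟩).snd * l + (φ ⟨0, 1⟩).snd * l - l - l := by ring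
    rw [this, map_sub, map_sub, map_add]
    simp only [mul_zero, sub_zero, zero_sub, map_neg, Nat.cast_ofNat, zero_mul, map_zero,
      add_zero] at h3
    linear_combination h3
  rw [map_eq_zero_iff _ hinj] at h4
  ext
  · exact hy.symm
  · simpa [h2, hne, sub_eq_zero] using h4

/-- The action of an automorphism on the quotient by the centre. -/
theorem reduceMul_map [Fact p.Prime] (hp : p ≠ 2) (hk : k ≠ 0) (φ : MulAut (SkewExtension p k))
    (g : SkewExtension p k) :
    reduceMul p k (φ g).fst = reduceMul p k (φ ⟨1, 0⟩).fst * reduceMul p k g.fst ∧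
      (φ g).snd = (φ ⟨1, 0⟩).snd * reduceMul p k g.fst + g.snd := by
  have hp0 : p ≠ 0 := (Fact.out : p.Prime).ne_zero
  have : NeZero (p * (p * k)) := ⟨by positivity⟩
  obtain ⟨-, -, y, hy⟩ := map_mk_zero_one hp hk φ
  -- The added term cancels the twist in the product of `(m, 0)` and `(0, j)`.
  obtain ⟨m, hm⟩ := ZMod.natCast_zmod_surjective (g.fst + embedMul p k (g.snd * reduceMul p k g.fst))
  obtain ⟨j, hj⟩ := ZMod.natCast_zmod_surjective g.snd
  have hg : g = ⟨1, 0⟩ ^ m * ⟨0, 1⟩ ^ j := by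
    rw [pow_eq, pow_eq]
    ext
    · simp only [fst_mul, mul_one, mul_zero, hm, hj, map_add, reduceMul_embedMul]
      simp
    · simp [hj]
  have hm' : (m : ZMod p) = reduceMul p k g.fst := by
    rw [← map_natCast (reduceMul p k), hm, map_add, reduceMul_embedMul, add_zero]
  have hφ : φ g = φ ⟨1, 0⟩ ^ m * φ ⟨0, 1⟩ ^ j := by
    rw [← map_pow, ← map_pow, ← map_mul, ← hg]
  rw [hφ, pow_eq, pow_eq, hy]
  constructor
  · rw [reduceMul_fst_mul, map_mul, map_mul, map_natCast, map_natCast, reduceMul_embedMul, hm']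
    ring
  · simp only [snd_mul, hm', hj]
    ring

/-- Modulo the centre an automorphism acts on `(ZMod p) ^ 2` by `(u, v) ↦ (l * u, μ * u + v)`. Inner
automorphisms act trivially there, so the pairs `(l, μ)` arising from `A` form an abelian group of
affine type: either all `l = 1`, or there is a common eigenvector `(1, ν)`. Each case yields a
noncentral element that would have to be central. -/
theorem not_isGroupIntegral [Fact p.Prime] (hp : p ≠ 2) (hk : k ≠ 0) (H : Type*) [Group H] :
    ¬ IsGroupIntegral (SkewExtension p k) H := by
  intro h
  obtain ⟨A, hA⟩ := h.exists_commutator_eq_inner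
  have hp0 : p ≠ 0 := (Fact.out : p.Prime).ne_zero
  have : NeZero (p * (p * k)) := ⟨by positivity⟩
  have hinj := embedMul_injective hp0 hk
  have h2 : (2 : ZMod p) ≠ 0 := by
    intro h
    have h := (ZMod.natCast_eq_zero_iff 2 p).mp (by exact_mod_cast h)
    exact hp ((Nat.prime_dvd_prime_iff_eq Fact.out Nat.prime_two).mp h)
  have hcenter : ∀ y, (⟨1, y⟩ : SkewExtension p k) ∉ Subgroup.center _ ∧
      (⟨0, 1⟩ : SkewExtension p k) ∉ Subgroup.center _ := by
    have key : ∀ y, (⟨0, 1⟩ : SkewExtension p k) * ⟨1, y⟩ ≠ ⟨1, y⟩ * ⟨0, 1⟩ := by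
      intro y h
      have h1 := congr_arg fst h
      simp only [fst_mul, map_one, map_zero, mul_zero, sub_zero, zero_sub, mul_one, zero_add,
        add_zero, add_right_inj] at h1
      have h3 := hinj h1
      exact h2 (by linear_combination h3)
    exact fun y => ⟨fun h => key y (Subgroup.mem_center_iff.mp h _),
      fun h => key y (Subgroup.mem_center_iff.mp h _).symm⟩
  by_cases hl : ∀ φ ∈ A, reduceMul p k (φ ⟨1, 0⟩).fst = 1
  -- All `φ ∈ A` fix the multiples of `c` and multiply `(0, 1)` by one of them, so they commute on
  -- `(0, 1)`.
  · refine (hcenter 0).2 (mem_center_of_commuting_action hA fun φ hφ ψ hψ => ?_)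
    have key : ∀ φ ∈ A, ∀ y, φ ⟨embedMul p k y, 0⟩ = ⟨embedMul p k y, 0⟩ := by
      intro φ hφ y
      have h1 := (map_mk_zero_one hp hk φ).2.1
      rw [hl φ hφ] at h1
      have h3 : (⟨embedMul p k y, 0⟩ : SkewExtension p k) = ⟨embedMul p k 1, 0⟩ ^ y.val := by
        rw [pow_eq]
        ext
        · simp only
          rw [← nsmul_eq_mul, ← map_nsmul, nsmul_eq_mul, mul_one, ZMod.natCast_zmod_val]
        · simp
      rw [h3, map_pow, h1]
    have split : ∀ y, (⟨embedMul p k y, 1⟩ : SkewExtension p k) = ⟨embedMul p k y, 0⟩ * ⟨0, 1⟩ := by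
      intro y
      ext
      · simp only [fst_mul, reduceMul_embedMul]
        simp
      · simp
    obtain ⟨-, -, y, hy⟩ := map_mk_zero_one hp hk φ
    obtain ⟨-, -, x, hx⟩ := map_mk_zero_one hp hk ψ
    rw [hy, hx, split, split, map_mul, map_mul, key φ hφ, key ψ hψ, hx, hy, split x, split y,
      ← mul_assoc, ← mul_assoc _ _ (⟨0, 1⟩ : SkewExtension p k)]
    congr 1
    ext
    · simp only [fst_mul, reduceMul_embedMul]
      simp [add_comm]
    · simp
  · push Not at hl
    obtain ⟨φ, hφ, hl⟩ := hl
    have hcomm : ∀ ψ ∈ A, (ψ ⟨1, 0⟩).snd * (reduceMul p k (φ ⟨1, 0⟩).fst - 1) =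
        (φ ⟨1, 0⟩).snd * (reduceMul p k (ψ ⟨1, 0⟩).fst - 1) := by
      intro ψ hψ
      have h1 : ⁅ψ, φ⁆ ∈ (MulAut.conj : SkewExtension p k →* _).range :=
        hA ▸ Subgroup.commutator_mem_commutator hψ hφ
      obtain ⟨g, hg⟩ := h1
      have h3 : ψ * φ = MulAut.conj g * (φ * ψ) := by
        rw [hg, commutatorElement_def]
        group
      have h4 := congr_arg (fun (χ : MulAut (SkewExtension p k)) => (χ ⟨1, 0⟩).snd) h3
      simp only [MulAut.mul_apply, MulAut.conj_apply, snd_mul, snd_inv] at h4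
      rw [(reduceMul_map hp hk ψ (φ _)).2, (reduceMul_map hp hk φ (ψ _)).2] at h4
      linear_combination h4
    -- This `ν` solves the eigenvector equation for `φ`; `hcomm` makes it work for every `ψ ∈ A`.
    set ν := (φ ⟨1, 0⟩).snd / (reduceMul p k (φ ⟨1, 0⟩).fst - 1) with hν
    refine (hcenter ν).1 (mem_center_of_forall_exists_pow hA fun ψ hψ => ?_)
    -- The powers of `(1, ν)` take every first coordinate, so agreement of the second coordinates
    -- suffices.
    refine ⟨(ψ ⟨1, ν⟩).fst.val, ?_⟩
    have h3 := reduceMul_map hp hk ψ ⟨1, ν⟩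
    rw [pow_eq]
    ext
    · simp
    · simp only [map_one, mul_one] at h3
      have h5 : (((ψ ⟨1, ν⟩).fst.val : ℕ) : ZMod p) = reduceMul p k (ψ ⟨1, ν⟩).fst := by
        rw [← map_natCast (reduceMul p k), ZMod.natCast_zmod_val]
      simp only [h5, h3.1, h3.2]
      have h6 := sub_ne_zero.mpr hl
      have h7 := hcomm ψ hψ
      have h8 : ν * (reduceMul p k (φ ⟨1, 0⟩).fst - 1) = (φ ⟨1, 0⟩).snd := div_mul_cancel₀ _ h6
      refine mul_right_cancel₀ h6 ?_
      linear_combination h7 + (1 - reduceMul p k (ψ ⟨1, 0⟩).fst) * h8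

end SkewExtension

theorem exists_card_eq_not_isGroupIntegral_of_cube_dvd {n p : ℕ} (hn : n ≠ 0) (hp : p.Prime)
    (hpn : p ^ 3 ∣ n) :
    ∃ (G : Type) (_ : Group G), Nat.card G = n ∧
      ∀ (H : Type u) [Group H], ¬ IsGroupIntegral G H := by
  have := Fact.mk hp
  obtain ⟨k, rfl⟩ := hpn
  have hk : k ≠ 0 := by rintro rfl; simp at hn
  by_cases h2 : p = 2
  · subst h2
    refine ⟨DihedralGroup (4 * k), inferInstance, ?_, fun H _ =>
      DihedralGroup.not_isGroupIntegral (by omega) H⟩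
    rw [DihedralGroup.nat_card]
    ring
  · exact ⟨SkewExtension p k, inferInstance, SkewExtension.card_eq p k, fun H _ =>
      SkewExtension.not_isGroupIntegral h2 hk H⟩

/-! ### Integrable orders and normal Sylow subgroups -/

/-- `n` is cube-free and no prime divisor of `n` divides `p - 1` for a prime divisor `p` of `n`. -/
def Nat.IsIntegrableOrder (n : ℕ) : Prop :=
  n.IsCubeFree ∧ ¬ ∃ p q : ℕ, p.Prime ∧ q.Prime ∧ p ∣ n ∧ q ∣ n ∧ q ∣ p - 1

theorem Nat.IsIntegrableOrder.of_dvd {m n : ℕ} (hn : n.IsIntegrableOrder) (h : m ∣ n) :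
    m.IsIntegrableOrder :=
  ⟨fun p hp hpm => hn.1 p hp (hpm.trans h), fun ⟨p, q, hp, hq, hpm, hqm, hqp⟩ =>
    hn.2 ⟨p, q, hp, hq, hpm.trans h, hqm.trans h, hqp⟩⟩

theorem Nat.IsCubeFree.pow_dvd_sq {n p k : ℕ} (hn : n.IsCubeFree) (hp : p.Prime) (h : p ^ k ∣ n) :
    p ^ k ∣ p ^ 2 :=
  pow_dvd_pow p (not_lt.mp fun hk => hn p hp ((pow_dvd_pow p hk).trans h))

theorem commute_of_card_dvd_prime_sq {P : Type*} [Group P] {p : ℕ} [Fact p.Prime]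
    (hP : Nat.card P ∣ p ^ 2) (a b : P) : a * b = b * a := by
  obtain ⟨k, hk, hP⟩ := (Nat.dvd_prime_pow Fact.out).mp hP
  interval_cases k
  · have := (Nat.card_eq_one_iff_unique.mp (hP.trans (pow_zero p))).1
    exact Subsingleton.elim _ _
  · have := isCyclic_of_prime_card (hP.trans (pow_one p))
    exact (IsCyclic.isMulCommutative : IsMulCommutative P).is_comm.comm a b
  · exact (IsPGroup.isMulCommutative_of_card_eq_prime_sq hP).is_comm.comm a b

/-- The subgroup of fixed points of an automorphism. -/
abbrev MulAut.fixedSubgroup {P : Type*} [Group P] (φ : MulAut P) : Subgroup P :=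
  φ.toMonoidHom.eqLocus (MonoidHom.id P)

theorem MulAut.mem_fixedSubgroup {P : Type*} [Group P] {φ : MulAut P} {v : P} :
    v ∈ φ.fixedSubgroup ↔ φ v = v := Iff.rfl

theorem MulAut.card_modEq_card_fixedSubgroup {P : Type*} [Group P] [Finite P] {r : ℕ}
    [Fact r.Prime] {φ : MulAut P} (hφ : orderOf φ = r) :
    Nat.card P ≡ Nat.card φ.fixedSubgroup [MOD r] := by
  have h1 : IsPGroup r (Subgroup.zpowers φ) :=
    IsPGroup.of_card (n := 1) (by rw [Nat.card_zpowers, hφ, pow_one])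
  have h2 : MulAction.fixedPoints (Subgroup.zpowers φ) P = φ.fixedSubgroup := by
    ext v
    rw [MulAction.mem_fixedPoints, SetLike.mem_coe, mem_fixedSubgroup]
    refine ⟨fun h => h ⟨φ, Subgroup.mem_zpowers φ⟩, fun h => ?_⟩
    have h3 : Subgroup.zpowers φ ≤ MulAction.stabilizer (MulAut P) v := by
      rw [Subgroup.zpowers_le]
      exact h
    exact fun m => h3 m.2
  have h3 := h1.card_modEq_card_fixedPoints P
  rw [h2] at h3
  exact h3

/-- With `p ^ k` elements and `p ^ l` fixed points, `l < k ≤ 2`, orbit counting gives `r ∣ p ^ k - p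
^ l`. Only `k = 2`, `l = 0` allows a divisor of `p + 1`. -/
theorem MulAut.dvd_of_orderOf_eq_prime {P : Type*} [Group P] [Finite P] {p r : ℕ} [Fact p.Prime]
    [Fact r.Prime] (hP : Nat.card P ∣ p ^ 2) {φ : MulAut P} (hφ : orderOf φ = r) (hr : r ≠ p) :
    r ∣ p - 1 ∨ (Nat.card P = p ^ 2 ∧ φ.fixedSubgroup = ⊥ ∧ r ∣ p + 1) := by
  have hp : p.Prime := Fact.out
  have hr' : r.Prime := Fact.out
  have h1 := MulAut.card_modEq_card_fixedSubgroup hφ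
  have h2 : Nat.card φ.fixedSubgroup ≠ Nat.card P := by
    intro h
    have h3 := Subgroup.eq_top_of_card_eq _ h
    have h4 : φ = 1 := MulEquiv.ext fun v => by
      have : v ∈ φ.fixedSubgroup := h3 ▸ Subgroup.mem_top v
      exact this
    rw [h4, orderOf_one] at hφ
    exact hr'.one_lt.ne hφ
  have h3 := Subgroup.card_subgroup_dvd_card φ.fixedSubgroup
  obtain ⟨k, hk, hP⟩ := (Nat.dvd_prime_pow Fact.out).mp hP
  rw [hP] at h1 h2 h3 ⊢
  obtain ⟨l, hl, hC⟩ := (Nat.dvd_prime_pow Fact.out).mp h3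
  rw [hC] at h1 h2
  have hlk : l < k := lt_of_le_of_ne hl fun h => h2 (by rw [h])
  have h4 : r ∣ p ^ k - p ^ l := (Nat.modEq_iff_dvd' (Nat.pow_le_pow_right hp.pos hl)).mp h1.symm
  interval_cases k
  · omega
  · interval_cases l
    left
    simpa using h4
  · interval_cases l
    · rw [pow_zero, show p ^ 2 - 1 = (p + 1) * (p - 1) from by
        simpa using Nat.sq_sub_sq p 1, hr'.dvd_mul] at h4
      refine h4.symm.imp id fun h => ⟨rfl, ?_, h⟩
      exact Subgroup.card_eq_one.mp (hC.trans (pow_zero p))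
    · left
      rw [pow_one, sq, ← Nat.mul_sub_one, hr'.dvd_mul] at h4
      exact h4.resolve_left fun h => hr ((Nat.prime_dvd_prime_iff_eq hr' hp).mp h)

/-- The hypothesis of Burnside's transfer theorem for the smallest prime `p`. A prime `r` dividing
`|N(P) : C(P)|` exceeds `p` and divides `p - 1` or `p + 1`, so `r = p + 1`; then `p ∣ r - 1` is
excluded. -/
theorem Sylow.normalizer_le_centralizer_of_isIntegrableOrder {G : Type*} [Group G] [Finite G]
    (hG : (Nat.card G).IsIntegrableOrder) {p : ℕ} [Fact p.Prime]
    (hp : (Nat.card G).minFac = p) (hpG : p ∣ Nat.card G) (P : Sylow p G) :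
    Subgroup.normalizer P ≤ Subgroup.centralizer (P : Set G) := by
  have hP : Nat.card P ∣ p ^ 2 := by
    obtain ⟨k, hk⟩ := P.2.exists_card_eq
    rw [hk]
    exact hG.1.pow_dvd_sq Fact.out (hk ▸ Subgroup.card_subgroup_dvd_card _)
  have : IsMulCommutative P := ⟨⟨commute_of_card_dvd_prime_sq hP⟩⟩
  rw [← Subgroup.relIndex_eq_one]
  by_contra hne
  obtain ⟨r, hr, hrdvd⟩ := Nat.exists_prime_and_dvd hne
  have := Fact.mk hr
  have hrp : r ≠ p := by
    rintro rfl
    exact P.not_dvd_index ((hrdvd.trans (Subgroup.relIndex_dvd_of_le_left _ P.le_centralizer)).trans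
      (Subgroup.relIndex_dvd_index_of_le P.le_normalizer))
  have hrG : r ∣ Nat.card G :=
    (hrdvd.trans (Subgroup.relIndex_dvd_card _ _)).trans (Subgroup.card_subgroup_dvd_card _)
  have hlt : p < r := lt_of_le_of_ne (hp ▸ Nat.minFac_le_of_dvd hr.two_le hrG) hrp.symm
  have hcard : r ∣ Nat.card P.normalizerMonoidHom.range := by
    rwa [← Subgroup.index_ker, Subgroup.normalizerMonoidHom_ker]
  obtain ⟨φ, hφ⟩ := exists_prime_orderOf_dvd_card' r hcard
  have h2 : 2 ≤ p := (Fact.out : p.Prime).two_le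
  rcases MulAut.dvd_of_orderOf_eq_prime hP (φ := φ.1) (by rwa [Subgroup.orderOf_coe]) hrp with
    h | ⟨-, -, h⟩
  · exact absurd (Nat.le_of_dvd (by omega) h) (by omega)
  · have h3 : r = p + 1 := le_antisymm (Nat.le_of_dvd (by omega) h) hlt
    exact hG.2 ⟨r, p, hr, Fact.out, hrG, hpG, by rw [h3]; simp⟩

/-- A nontrivial group of integrable order has a nontrivial normal Sylow subgroup. -/
theorem exists_normal_sylow_of_isIntegrableOrder {G : Type*} [Group G] [Finite G] [Nontrivial G]
    (hG : (Nat.card G).IsIntegrableOrder) :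
    ∃ p : ℕ, p.Prime ∧ p ∣ Nat.card G ∧ ∃ P : Subgroup G, P.Normal ∧ IsPGroup p P ∧
      ¬ p ∣ P.index := by
  induction hn : Nat.card G using Nat.strong_induction_on generalizing G with
  | _ n ih =>
  subst hn
  have hne : Nat.card G ≠ 1 := Finite.one_lt_card.ne'
  set p := (Nat.card G).minFac with hp
  have hpp : p.Prime := Nat.minFac_prime hne
  have := Fact.mk hpp
  have hpG : p ∣ Nat.card G := Nat.minFac_dvd _
  obtain ⟨P⟩ : Nonempty (Sylow p G) := inferInstance
  have hle := P.normalizer_le_centralizer_of_isIntegrableOrder hG hp.symm hpG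
  have hcompl := MonoidHom.ker_transferSylow_isComplement' P hle
  have hpK := MonoidHom.not_dvd_card_ker_transferSylow P hle
  set K := (MonoidHom.transferSylow P hle).ker with hK
  have hKn : K.Normal := MonoidHom.normal_ker _
  have hKi : K.index = Nat.card P := hcompl.symm.index_eq_card
  by_cases hK1 : Nat.card K = 1
  · refine ⟨p, hpp, hpG, P, ?_, P.2, P.not_dvd_index⟩
    rw [Subgroup.card_eq_one.mp hK1, Subgroup.isComplement'_bot_left] at hcompl
    rw [hcompl]
    infer_instance
  · have : Nontrivial K := Finite.one_lt_card_iff_nontrivial.mp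
      (lt_of_le_of_ne Nat.card_pos (Ne.symm hK1))
    have hKG : Nat.card K ∣ Nat.card G := Subgroup.card_subgroup_dvd_card K
    have hlt : Nat.card K < Nat.card G :=
      lt_of_le_of_ne (Nat.le_of_dvd Nat.card_pos hKG) fun h => hpK (h ▸ hpG)
    obtain ⟨q, hq, hqK, Q, hQn, hQ, hQi⟩ := ih _ hlt (G := K) (hG.of_dvd hKG) rfl
    have := Fact.mk hq
    -- A normal Sylow subgroup of the normal `p`-complement is characteristic in it, hence normal in
    -- `G`.
    have hchar : Q.Characteristic := (hQ.toSylow hQi).characteristic_of_normal hQn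
    refine ⟨q, hq, hqK.trans hKG, Q.map K.subtype, ConjAct.normal_of_characteristic_of_normal,
      hQ.map _, ?_⟩
    rw [Subgroup.index_map_subtype, hq.dvd_mul, hKi]
    obtain ⟨k, hk⟩ := P.2.exists_card_eq
    rintro (h | h)
    · exact hQi h
    · rw [hk] at h
      have := (Nat.prime_dvd_prime_iff_eq hq hpp).mp (hq.dvd_of_dvd_pow h)
      exact hpK (this ▸ hqK)

/-! ### Automorphisms of groups of order dividing `p ^ 2` -/

/-- Multiplicative automorphisms of a commutative group as units of the endomorphism ring of its
additive version. -/
def MulAut.toAddMonoidEnd (P : Type*) [CommGroup P] : MulAut P →* AddMonoid.End (Additive P) where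
  toFun x := MonoidHom.toAdditive x.toMonoidHom
  map_one' := rfl
  map_mul' _ _ := rfl

/-- The centralizer of an irreducible automorphism `β` acts on the group as multiplications of a
finite field. -/
theorem MulAut.exists_field_of_irreducible {P : Type u} [CommGroup P] [Finite P] [Nontrivial P]
    {β : MulAut P} (hβ : ∀ Q : Subgroup P, (∀ v ∈ Q, β v ∈ Q) → Q = ⊥ ∨ Q = ⊤) :
    ∃ (K : Type u) (_ : Field K) (_ : Finite K) (e : Multiplicative K ≃* P)
      (ι : Subgroup.centralizer {β} →* K),
        Function.Injective ι ∧
          ∀ x k, e (Multiplicative.ofAdd (ι x * k)) = x.1 (e (Multiplicative.ofAdd k)) := by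
  let b := toAddMonoidEnd P β
  -- Schur's lemma: kernels of elements of `D` are `β`-invariant, so `D` is a finite domain, hence a
  -- field by Wedderburn.
  let D := Subring.centralizer {b}
  have hD : ∀ d : D, ∀ v, (d.1 (b v) : Additive P) = b (d.1 v) := fun d v => by
    have h := (Subring.mem_centralizer_iff.mp d.2) b rfl
    exact (DFunLike.congr_fun h v).symm
  have hker : ∀ d : D, d ≠ 0 → ∀ v, d.1 v = 0 → v = 0 := by
    intro d hd v hv
    let Q : Subgroup P := (AddMonoidHom.toMultiplicative d.1 :
      Multiplicative (Additive P) →* Multiplicative (Additive P)).ker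
    have hQ : ∀ w : P, w ∈ Q ↔ d.1 (Additive.ofMul w) = 0 := fun w => Iff.rfl
    rcases hβ Q (fun w hw => by
      rw [hQ] at hw ⊢
      have := hD d (Additive.ofMul w)
      rw [hw, map_zero] at this
      exact this) with h | h
    · have h1 : (Additive.toMul v) ∈ Q := (hQ _).mpr hv
      rw [h, Subgroup.mem_bot] at h1
      exact h1
    · refine absurd (Subtype.ext (AddMonoidHom.ext fun w => ?_)) hd
      have h1 : (Additive.toMul w) ∈ Q := h ▸ Subgroup.mem_top _
      exact (hQ _).mp h1
  have : Finite (AddMonoid.End (Additive P)) := DFunLike.finite _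
  have : Finite D := inferInstance
  have : Nontrivial D := by
    obtain ⟨v, hv⟩ := exists_ne (1 : P)
    refine ⟨0, 1, fun h => hv ?_⟩
    have := DFunLike.congr_fun (congr_arg Subtype.val h) (Additive.ofMul v)
    exact this.symm
  have : NoZeroDivisors D := ⟨fun {c d} h => by
    by_contra! hcd
    refine hcd.2 (Subtype.ext (AddMonoidHom.ext fun w => ?_))
    exact hker c hcd.1 _ (DFunLike.congr_fun (congr_arg Subtype.val h) w)⟩
  have : IsDomain D := NoZeroDivisors.to_isDomain D
  have hfield : IsField D := Finite.isDomain_to_isField D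
  obtain ⟨v₀, hv₀⟩ := exists_ne (1 : P)
  -- Evaluation at `v₀` has a nontrivial `β`-invariant image, so it identifies `D` with `P`.
  let ev : Multiplicative D →* P :=
    { toFun := fun d => Additive.toMul ((Multiplicative.toAdd d).1 (Additive.ofMul v₀))
      map_one' := rfl
      map_mul' := fun _ _ => rfl }
  have hinj : Function.Injective ev := by
    rw [injective_iff_map_eq_one]
    intro d hd
    by_contra h
    exact hv₀ (hker (Multiplicative.toAdd d) h (Additive.ofMul v₀) hd)
  have hsurj : Function.Surjective ev := by
    rw [← MonoidHom.range_eq_top]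
    refine (hβ ev.range ?_).resolve_left fun h => ?_
    · rintro _ ⟨d, rfl⟩
      refine ⟨Multiplicative.ofAdd (⟨b, Subring.mem_centralizer_iff.mpr ?_⟩ *
        Multiplicative.toAdd d), rfl⟩
      rintro _ rfl
      rfl
    · have h1 : v₀ ∈ ev.range := ⟨Multiplicative.ofAdd 1, rfl⟩
      rw [h, Subgroup.mem_bot] at h1
      exact hv₀ h1
  let ι : Subgroup.centralizer {β} →* D :=
    ((toAddMonoidEnd P).comp (Subgroup.subtype _)).codRestrict D fun x => by
      rw [Subring.mem_centralizer_iff]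
      rintro _ rfl
      have h := (Subgroup.mem_centralizer_iff.mp x.2) β rfl
      exact congr_arg (toAddMonoidEnd P) h
  exact ⟨D, hfield.toField, inferInstance, MulEquiv.ofBijective ev ⟨hinj, hsurj⟩, ι,
    fun x y h => Subtype.ext (MulEquiv.ext fun v => DFunLike.congr_fun (congr_arg Subtype.val h)
      (Additive.ofMul v)), fun x k => rfl⟩

theorem MulAut.isCyclic_centralizer_of_irreducible {P : Type*} [CommGroup P] [Finite P] [Nontrivial P]
    {β : MulAut P} (hβ : ∀ Q : Subgroup P, (∀ v ∈ Q, β v ∈ Q) → Q = ⊥ ∨ Q = ⊤) :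
    IsCyclic (Subgroup.centralizer {β}) := by
  obtain ⟨K, _, _, e, ι, hinj, hι⟩ := exists_field_of_irreducible hβ
  have : Finite (MulAut P) := DFunLike.finite _
  exact isCyclic_of_injective_ringHom ι hinj

/-- Automorphisms that commute with an irreducible automorphism of a group of order dividing `p ^ 2`
and have order coprime to `p - 1` are inverted by a common automorphism. -/
theorem MulAut.exists_inverting_of_irreducible {P : Type*} [CommGroup P] [Finite P] [Nontrivial P]
    {p : ℕ} [Fact p.Prime] (hP : Nat.card P ∣ p ^ 2)
    {β : MulAut P} (hβ : ∀ Q : Subgroup P, (∀ v ∈ Q, β v ∈ Q) → Q = ⊥ ∨ Q = ⊤) :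
    ∃ τ : MulAut P, ∀ x, x * β = β * x → (orderOf x).Coprime (p - 1) → τ * x = x⁻¹ * τ := by
  obtain ⟨K, _, _, e, ι, hinj, hι⟩ := exists_field_of_irreducible hβ
  have : Fintype K := Fintype.ofFinite K
  have hp : p.Prime := Fact.out
  have hcard : Nat.card K = Nat.card P := Nat.card_congr e.toEquiv
  obtain ⟨f, hf, hPf⟩ := (Nat.dvd_prime_pow Fact.out).mp hP
  rw [hPf] at hcard
  have : CharP K p := charP_of_card_eq_prime_pow (f := f) (by rw [Fintype.card_eq_nat_card, hcard])
  let F : Multiplicative K ≃* Multiplicative K :=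
    AddEquiv.toMultiplicative (frobeniusEquiv K p).toAddEquiv
  refine ⟨(e.symm.trans F).trans e, fun x hx hxp => ?_⟩
  let x' : Subgroup.centralizer {β} := ⟨x, by
    rw [Subgroup.mem_centralizer_iff]
    rintro _ rfl
    exact hx.symm⟩
  have hx0 : ι x' ≠ 0 := by
    intro h
    have := map_mul ι x' x'⁻¹
    rw [h, zero_mul, mul_inv_cancel, map_one] at this
    exact one_ne_zero this
  -- The order divides `|K| - 1`, hence `(p - 1) * (p + 1)`, and is prime to `p - 1`. Frobenius `k ↦
  -- k ^ p` then conjugates multiplication by `x` to multiplication by `x ^ p = x⁻¹`.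
  have h1 : x' ^ (p + 1) = 1 := by
    have h2 : x' ^ ((p - 1) * (p + 1)) = 1 := by
      apply hinj
      rw [map_pow, map_one]
      have h3 := FiniteField.pow_card_sub_one_eq_one (ι x') hx0
      rw [Fintype.card_eq_nat_card, hcard] at h3
      rw [← orderOf_dvd_iff_pow_eq_one] at h3 ⊢
      refine h3.trans ?_
      have h4 : p ^ 2 - 1 = (p - 1) * (p + 1) := by
        rw [mul_comm]
        simpa using Nat.sq_sub_sq p 1
      interval_cases f
      · exact absurd hcard (Finite.one_lt_card (α := K)).ne'
      · rw [pow_one]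
        exact dvd_mul_right _ _
      · rw [h4]
    rw [← orderOf_dvd_iff_pow_eq_one] at h2 ⊢
    have h3 : orderOf x' = orderOf x := (Subgroup.orderOf_coe x').symm
    exact Nat.Coprime.dvd_of_dvd_mul_left (h3 ▸ hxp) h2
  have h2 : ι x' ^ p = ι x'⁻¹ := by
    rw [← map_pow]
    congr 1
    rw [eq_inv_iff_mul_eq_one, ← pow_succ, h1]
  ext v
  obtain ⟨k, rfl⟩ := e.surjective v
  have h3 := hι x' (Multiplicative.toAdd k)
  have h4 := hι x'⁻¹ (Multiplicative.toAdd k ^ p)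
  rw [← h2, ← mul_pow] at h4
  simp only [MulAut.mul_apply, MulEquiv.trans_apply, MulEquiv.symm_apply_apply]
  change e (F (e.symm (x'.1 (e (Multiplicative.ofAdd (Multiplicative.toAdd k)))))) = _
  rw [← h3, MulEquiv.symm_apply_apply]
  exact h4

section PrimeSqAction

variable {P : Type*} {p : ℕ} [Fact p.Prime]

/-- A nontrivial element of a finite group has a power of prime order dividing its order. -/
theorem exists_pow_orderOf_prime {G : Type*} [Group G] [Finite G] {x : G} (hx : x ≠ 1) :
    ∃ r m : ℕ, r.Prime ∧ r ∣ orderOf x ∧ orderOf (x ^ m) = r := by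
  have h1 : orderOf x ≠ 1 := fun h => hx (orderOf_eq_one_iff.mp h)
  obtain ⟨r, hr, hrx⟩ := Nat.exists_prime_and_dvd h1
  refine ⟨r, orderOf x / r, hr, hrx, ?_⟩
  exact orderOf_pow_orderOf_div (orderOf_pos x).ne' hrx

theorem MulAut.nontrivial_of_ne_one [Group P] {x : MulAut P} (hx : x ≠ 1) : Nontrivial P := by
  by_contra h
  rw [not_nontrivial_iff_subsingleton] at h
  exact hx (MulEquiv.ext fun v => Subsingleton.elim _ _)

theorem MulAut.fixedSubgroup_eq_bot [Group P] [Finite P] (hP : Nat.card P ∣ p ^ 2) {x : MulAut P}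
    (hx : x ≠ 1) (hpx : ∀ r : ℕ, r.Prime → r ∣ orderOf x → r ≠ p ∧ ¬ r ∣ p - 1) :
    x.fixedSubgroup = ⊥ := by
  have : Finite (MulAut P) := DFunLike.finite _
  obtain ⟨r, m, hr, hrx, hm⟩ := exists_pow_orderOf_prime hx
  have := Fact.mk hr
  obtain ⟨hrp, hrp1⟩ := hpx r hr hrx
  have h := ((MulAut.dvd_of_orderOf_eq_prime hP hm hrp).resolve_left hrp1).2.1
  rw [eq_bot_iff, ← h]
  intro v hv
  have h2 : x ∈ MulAction.stabilizer (MulAut P) v := hv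
  exact Subgroup.pow_mem _ h2 m

/-- On a proper nontrivial invariant subgroup `x` would act without nontrivial fixed points, hence
nontrivially; a prime order power of this action would have order `p` or dividing `p - 1`. -/
theorem MulAut.irreducible_of_ne_one [Group P] [Finite P] (hP : Nat.card P ∣ p ^ 2) {x : MulAut P}
    (hx : x ≠ 1) (hpx : ∀ r : ℕ, r.Prime → r ∣ orderOf x → r ≠ p ∧ ¬ r ∣ p - 1)
    (Q : Subgroup P) (hQ : ∀ v ∈ Q, x v ∈ Q) : Q = ⊥ ∨ Q = ⊤ := by
  have : Finite (MulAut P) := DFunLike.finite _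
  by_contra! hne
  have hQtop : Nat.card Q ≠ p ^ 2 := by
    intro h
    refine hne.2 (Subgroup.eq_top_of_card_eq Q (Nat.dvd_antisymm ?_ (h ▸ hP)))
    exact Subgroup.card_subgroup_dvd_card Q
  have hfix := MulAut.fixedSubgroup_eq_bot hP hx hpx
  let f : Q →* Q := (x.toMonoidHom.comp Q.subtype).codRestrict Q fun v => hQ v v.2
  have hf : Function.Bijective f := by
    refine Finite.injective_iff_bijective.mp fun v w h => ?_
    exact Subtype.ext (x.injective (congr_arg Subtype.val h))
  let y : MulAut Q := MulEquiv.ofBijective f hf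
  have hyx : ∀ (m : ℕ) (v : Q), ((y ^ m) v : P) = (x ^ m) v := by
    intro m
    induction m with
    | zero => exact fun v => rfl
    | succ m ih =>
      intro v
      rw [pow_succ, pow_succ, MulAut.mul_apply, MulAut.mul_apply, ih]
      rfl
  have hord : orderOf y ∣ orderOf x := by
    rw [orderOf_dvd_iff_pow_eq_one]
    ext v
    rw [hyx, pow_orderOf_eq_one]
    rfl
  have hy : y ≠ 1 := by
    intro hy
    obtain ⟨v, hv, hv1⟩ := Q.bot_or_exists_ne_one.resolve_left hne.1
    refine hv1 ?_
    rw [← Subgroup.mem_bot, ← hfix]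
    exact congr_arg Subtype.val (DFunLike.congr_fun hy ⟨v, hv⟩)
  have : Finite (MulAut Q) := DFunLike.finite _
  obtain ⟨r, m, hr, hry, hm⟩ := exists_pow_orderOf_prime hy
  have := Fact.mk hr
  obtain ⟨hrp, hrp1⟩ := hpx r hr (hry.trans hord)
  exact hQtop ((MulAut.dvd_of_orderOf_eq_prime ((Subgroup.card_subgroup_dvd_card Q).trans hP) hm
    hrp).resolve_left hrp1).1

/-- A normal cyclic Sylow subgroup is central in a group of integrable order. -/
theorem le_center_of_isCyclic_of_isIntegrableOrder {X : Type*} [Group X] [Finite X]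
    (hX : (Nat.card X).IsIntegrableOrder) {r : ℕ} [Fact r.Prime] (R : Subgroup X) [R.Normal]
    [IsCyclic R] (hrX : r ∣ Nat.card X) (hR : IsPGroup r R) (hRi : ¬ r ∣ R.index) :
    R ≤ Subgroup.center X := by
  have hr : r.Prime := Fact.out
  let f : X →* MulAut R := MulAut.conjNormal
  have hker : R ≤ f.ker := by
    intro a ha
    rw [MonoidHom.mem_ker]
    ext v
    have : (⟨a, ha⟩ : R) * v = v * ⟨a, ha⟩ :=
      (IsCyclic.isMulCommutative : IsMulCommutative R).is_comm.comm _ _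
    have h := congr_arg Subtype.val this
    simp only [Subgroup.coe_mul] at h
    simp [f, h]
  have h1 : Nat.card f.range ∣ R.index := by
    rw [← Subgroup.index_ker]
    exact Subgroup.index_dvd_of_le hker
  have hcop : (Nat.card f.range).Coprime (Nat.card (MulAut R)) := by
    obtain ⟨k, hk⟩ := hR.exists_card_eq
    rw [IsCyclic.card_mulAut, hk]
    rcases Nat.eq_zero_or_pos k with rfl | hk0
    · simp
    rw [Nat.totient_prime_pow hr hk0]
    refine (Nat.Coprime.pow_right _ ?_).mul_right ?_
    · exact (hr.coprime_iff_not_dvd.mpr fun h => hRi (h.trans h1)).symm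
    · refine Nat.coprime_of_dvd fun s hs h2 h3 => hX.2 ⟨r, s, hr, hs, hrX, ?_, h3⟩
      exact h2.trans (Subgroup.card_range_dvd f)
  have : Finite (MulAut R) := DFunLike.finite _
  have hbot : f.range = ⊥ := by
    rw [← Subgroup.card_eq_one]
    exact Nat.eq_one_of_dvd_coprimes hcop dvd_rfl (Subgroup.card_subgroup_dvd_card _)
  intro a ha
  rw [Subgroup.mem_center_iff]
  intro g
  have h2 : f g = 1 := by
    rw [← Subgroup.mem_bot, ← hbot]
    exact ⟨g, rfl⟩
  have h3 := congr_arg Subtype.val (DFunLike.congr_fun h2 ⟨a, ha⟩)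
  simp only [f, MulAut.conjNormal_apply, MulAut.one_apply] at h3
  exact mul_inv_eq_iff_eq_mul.mp h3

variable [CommGroup P] [Finite P]

/-- A group of automorphisms of integrable order of a group of order dividing `p ^ 2`, of order
prime to `p * (p - 1)`, is trivial or lies in the centralizer of an irreducible element. -/
theorem MulAut.exists_mem_le_centralizer (hP : Nat.card P ∣ p ^ 2) {X : Subgroup (MulAut P)}
    (hX : (Nat.card X).IsIntegrableOrder)
    (hpX : ∀ r : ℕ, r.Prime → r ∣ Nat.card X → r ≠ p ∧ ¬ r ∣ p - 1) (hne : X ≠ ⊥) :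
    ∃ β ∈ X, β ≠ 1 ∧ X ≤ Subgroup.centralizer {β} := by
  have : Finite (MulAut P) := DFunLike.finite _
  have : Nontrivial X := (Subgroup.nontrivial_iff_ne_bot X).mpr hne
  obtain ⟨r, hr, hrX, R, hRn, hR, hRi⟩ := exists_normal_sylow_of_isIntegrableOrder hX
  have := Fact.mk hr
  have hRne : R ≠ ⊥ := by
    rintro rfl
    rw [Subgroup.index_bot] at hRi
    exact hRi hrX
  obtain ⟨β, hβR, hβ⟩ := R.bot_or_exists_ne_one.resolve_left hRne
  have hβ' : (β : MulAut P) ≠ 1 := fun h => hβ (Subtype.ext h)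
  have := MulAut.nontrivial_of_ne_one hβ'
  have hirr := MulAut.irreducible_of_ne_one hP hβ' fun s hs hsβ => hpX s hs (by
    rw [Subgroup.orderOf_coe] at hsβ
    exact hsβ.trans (orderOf_dvd_natCard β))
  have hcyc := MulAut.isCyclic_centralizer_of_irreducible hirr
  have hcomm : ∀ a b : R, a * b = b * a := by
    refine commute_of_card_dvd_prime_sq (p := r) ?_
    obtain ⟨k, hk⟩ := hR.exists_card_eq
    rw [hk]
    exact hX.1.pow_dvd_sq hr (hk ▸ Subgroup.card_subgroup_dvd_card _)
  -- `R` is abelian, so it lies in the centralizer of the irreducible `β`, which is cyclic.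
  have hRc : IsCyclic R := by
    let f : R →* Subgroup.centralizer {(β : MulAut P)} :=
      (X.subtype.comp R.subtype).codRestrict _ fun a => by
        rw [Subgroup.mem_centralizer_iff]
        rintro _ rfl
        exact congr_arg (fun a : R => ((a : X) : MulAut P)) (hcomm ⟨β, hβR⟩ a)
    refine isCyclic_of_injective f fun a b h => ?_
    exact Subtype.ext (Subtype.ext (congr_arg (Subgroup.centralizer {(β : MulAut P)}).subtype h))
  have hle := le_center_of_isCyclic_of_isIntegrableOrder hX R hrX hR hRi
  refine ⟨β, β.2, hβ', fun x hx => ?_⟩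
  rw [Subgroup.mem_centralizer_iff]
  rintro _ rfl
  exact (congr_arg Subtype.val (Subgroup.mem_center_iff.mp (hle hβR) ⟨x, hx⟩)).symm

/-- `τ` is inversion if `X` is trivial and Frobenius otherwise. The last alternative, surjectivity
of `β - 1`, will place `P` inside the derived subgroup of `P ⋊ K`. -/
theorem MulAut.exists_inverting (hP : Nat.card P ∣ p ^ 2) {X : Subgroup (MulAut P)}
    (hX : (Nat.card X).IsIntegrableOrder)
    (hpX : ∀ r : ℕ, r.Prime → r ∣ Nat.card X → r ≠ p ∧ ¬ r ∣ p - 1) :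
    (∀ x ∈ X, ∀ y ∈ X, x * y = y * x) ∧ ∃ τ : MulAut P, (∀ x ∈ X, τ * x = x⁻¹ * τ) ∧
      ((∀ v, τ v = v⁻¹) ∨ ∃ β ∈ X, ∀ v, ∃ w, β w = v * w) := by
  have : Finite (MulAut P) := DFunLike.finite _
  by_cases hne : X = ⊥
  · subst hne
    simp only [Subgroup.mem_bot, forall_eq, true_and]
    exact ⟨MulEquiv.inv P, by simp, Or.inl fun v => rfl⟩
  obtain ⟨β, hβX, hβ, hle⟩ := MulAut.exists_mem_le_centralizer hP hX hpX hne
  have := MulAut.nontrivial_of_ne_one hβ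
  have hord : ∀ x ∈ X, orderOf x ∣ Nat.card X := fun x hx =>
    (Subgroup.orderOf_mk x hx) ▸ orderOf_dvd_natCard (⟨x, hx⟩ : X)
  have hpβ : ∀ r : ℕ, r.Prime → r ∣ orderOf β → r ≠ p ∧ ¬ r ∣ p - 1 := fun r hr h =>
    hpX r hr (h.trans (hord β hβX))
  have hirr := MulAut.irreducible_of_ne_one hP hβ hpβ
  have hcyc := MulAut.isCyclic_centralizer_of_irreducible hirr
  refine ⟨fun x hx y hy => ?_, ?_⟩
  · have := (IsCyclic.isMulCommutative : IsMulCommutative (Subgroup.centralizer {β})).is_comm.comm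
      ⟨x, hle hx⟩ ⟨y, hle hy⟩
    exact congr_arg Subtype.val this
  · obtain ⟨τ, hτ⟩ := MulAut.exists_inverting_of_irreducible hP hirr
    refine ⟨τ, fun x hx => hτ x ?_ ?_, Or.inr ⟨β, hβX, fun v => ?_⟩⟩
    · exact (Subgroup.mem_centralizer_iff.mp (hle hx) β rfl).symm
    · exact Nat.coprime_of_dvd fun s hs h2 h3 => (hpX s hs (h2.trans (hord x hx))).2 h3
    · let f : P →* P := β.toMonoidHom / MonoidHom.id P
      have hf : Function.Surjective f := by
        refine Finite.injective_iff_surjective.mp ?_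
        rw [injective_iff_map_eq_one]
        intro w hw
        rw [← Subgroup.mem_bot, ← MulAut.fixedSubgroup_eq_bot hP hβ hpβ]
        exact div_eq_one.mp hw
      obtain ⟨w, hw⟩ := hf v
      exact ⟨w, div_eq_iff_eq_mul.mp hw⟩

end PrimeSqAction

/-! ### Automorphisms inverting the abelianization -/

/-- An automorphism `τ` of `N` that inverts the abelian image of `K` in `MulAut N`, and one of `K` that
inverts the abelianization of `K`, combine to one of `N ⋊ K` that inverts its abelianization, if
`τ` inverts `N` or `N` lies in the derived subgroup. -/
theorem SemidirectProduct.exists_inverting_abelianization {N K : Type*} [Group N] [Group K]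
    {f : K →* MulAut N} (hcomm : ∀ x ∈ f.range, ∀ y ∈ f.range, x * y = y * x)
    {τ : MulAut N} (hτ : ∀ x ∈ f.range, τ * x = x⁻¹ * τ)
    (hN : (∀ v, τ v = v⁻¹) ∨ ∃ β ∈ f.range, ∀ v, ∃ w, β w = v * w)
    {σ : MulAut K} (hσ : ∀ k, Abelianization.of (σ k) = (Abelianization.of k)⁻¹) :
    ∃ ρ : MulAut (N ⋊[f] K), ∀ g, Abelianization.of (ρ g) = (Abelianization.of g)⁻¹ := by
  -- `f` has abelian image, so it factors through the abelianization of `K`. This makes `τ` and `σ`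
  -- compatible with the action.
  have hfσ : ∀ k, f (σ k) = (f k)⁻¹ := by
    intro k
    have h1 : σ k * k ∈ commutator K := by
      rw [← Abelianization.ker_of, MonoidHom.mem_ker, map_mul, hσ, inv_mul_cancel]
    have h2 : commutator K ≤ f.ker := by
      rw [commutator_def, Subgroup.commutator_le]
      intro a _ b _
      rw [MonoidHom.mem_ker, map_commutatorElement, commutatorElement_eq_one_iff_mul_comm]
      exact hcomm _ ⟨a, rfl⟩ _ ⟨b, rfl⟩
    have h3 := MonoidHom.mem_ker.mp (h2 h1)
    rw [map_mul] at h3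
    exact eq_inv_of_mul_eq_one_left h3
  let ρ : MulAut (N ⋊[f] K) := SemidirectProduct.congr τ σ fun k => by
    have := hτ (f k) ⟨k, rfl⟩
    rw [← hfσ] at this
    ext v
    exact DFunLike.congr_fun this v
  have hl : ∀ v, ρ (inl v) = inl (τ v) := fun v => by ext <;> simp [ρ]
  have hr : ∀ k, ρ (inr k) = inr (σ k) := fun k => by ext <;> simp [ρ]
  refine ⟨ρ, fun g => ?_⟩
  suffices h : Abelianization.of.comp ρ.toMonoidHom =
      (MulEquiv.inv (Abelianization (N ⋊[f] K))).toMonoidHom.comp Abelianization.of from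
    DFunLike.congr_fun h g
  apply SemidirectProduct.hom_ext
  · ext v
    change Abelianization.of (ρ (inl v)) = (Abelianization.of (inl v))⁻¹
    rw [hl]
    rcases hN with h | ⟨_, ⟨k, rfl⟩, h⟩
    · rw [h, map_inv, map_inv]
    · have h1 : ∀ v, Abelianization.of (inl v : N ⋊[f] K) = 1 := by
        intro v
        obtain ⟨w, hw⟩ := h v
        have h2 := inl_aut (φ := f) k w
        rw [hw] at h2
        have h3 := congr_arg Abelianization.of h2
        rw [map_mul, map_mul, map_mul, map_mul, map_inv, map_inv, mul_comm, mul_comm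
          (Abelianization.of (inr k)), mul_inv_cancel_right] at h3
        simpa using h3
      rw [h1, h1, inv_one]
  · ext k
    change Abelianization.of (ρ (inr k)) = (Abelianization.of (inr k))⁻¹
    rw [hr]
    have h1 : σ k * k ∈ commutator K := by
      rw [← Abelianization.ker_of, MonoidHom.mem_ker, map_mul, hσ, inv_mul_cancel]
    have h2 : commutator K ≤ (Abelianization.of.comp (inr : K →* N ⋊[f] K)).ker :=
      Abelianization.commutator_subset_ker _
    have h3 := MonoidHom.mem_ker.mp (h2 h1)
    rw [map_mul] at h3
    exact eq_inv_of_mul_eq_one_left h3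

/-- A group of integrable order has an automorphism that inverts its abelianization. -/
theorem exists_inverting_abelianization {G : Type*} [Group G] [Finite G]
    (hG : (Nat.card G).IsIntegrableOrder) :
    ∃ σ : MulAut G, ∀ g, Abelianization.of (σ g) = (Abelianization.of g)⁻¹ := by
  induction hn : Nat.card G using Nat.strong_induction_on generalizing G with
  | _ n ih =>
  subst hn
  rcases subsingleton_or_nontrivial G with _ | _
  · refine ⟨1, fun g => ?_⟩
    rw [Subsingleton.elim g 1]
    simp
  obtain ⟨p, hp, hpG, P, hPn, hP, hPi⟩ := exists_normal_sylow_of_isIntegrableOrder hG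
  have := Fact.mk hp
  obtain ⟨k, hk⟩ := hP.exists_card_eq
  have hPsq : Nat.card P ∣ p ^ 2 := by
    rw [hk]
    exact hG.1.pow_dvd_sq hp (hk ▸ Subgroup.card_subgroup_dvd_card _)
  obtain ⟨K, hK⟩ := Subgroup.exists_right_complement'_of_coprime (N := P) (by
    rw [hk]
    exact ((Nat.Prime.coprime_iff_not_dvd hp).mpr hPi).pow_left k)
  have hKi : P.index = Nat.card K := hK.symm.index_eq_card
  have hKG : Nat.card K ∣ Nat.card G := Subgroup.card_subgroup_dvd_card K
  have hlt : Nat.card K < Nat.card G :=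
    lt_of_le_of_ne (Nat.le_of_dvd Nat.card_pos hKG) fun h => hPi (hKi ▸ h ▸ hpG)
  obtain ⟨σ, hσ⟩ := ih _ hlt (G := K) (hG.of_dvd hKG) rfl
  let _ : CommGroup P :=
    { (inferInstance : Group P) with mul_comm := commute_of_card_dvd_prime_sq hPsq }
  let e := SemidirectProduct.mulEquivSubgroup hK
  set f : K →* MulAut P := P.normalizerMonoidHom.comp
    (Subgroup.inclusion (P.normalizer_eq_top ▸ le_top)) with hf
  have hfK : Nat.card f.range ∣ Nat.card K := Subgroup.card_range_dvd f
  obtain ⟨hcomm, τ, hτ, hN⟩ := MulAut.exists_inverting hPsq (X := f.range)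
    (hG.of_dvd (hfK.trans hKG)) fun r hr hrX => by
      refine ⟨?_, fun h => hG.2 ⟨p, r, hp, hr, hpG, (hrX.trans hfK).trans hKG, h⟩⟩
      rintro rfl
      exact hPi (hKi ▸ hrX.trans hfK)
  obtain ⟨ρ, hρ⟩ := SemidirectProduct.exists_inverting_abelianization hcomm hτ hN hσ
  refine ⟨(e.symm.trans ρ).trans e, fun g => ?_⟩
  obtain ⟨x, rfl⟩ := e.surjective g
  have h1 : ρ x * x ∈ commutator _ := by
    rw [← Abelianization.ker_of, MonoidHom.mem_ker, map_mul, hρ, inv_mul_cancel]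
  have h2 := MonoidHom.mem_ker.mp
    (Abelianization.commutator_subset_ker (Abelianization.of.comp e.toMonoidHom) h1)
  rw [map_mul] at h2
  simpa using eq_inv_of_mul_eq_one_left h2

/-! ### Construction of integrals -/

/-- The derived subgroup of `N ⋊ ⟨σ⟩` is `N` if `N` has odd order and `σ` inverts `Nᵃᵇ`. -/
theorem isGroupIntegrable_of_odd_of_inverting {G : Type u} [Group G] [Finite G]
    (hG : Odd (Nat.card G)) {σ : MulAut G}
    (hσ : ∀ g, Abelianization.of (σ g) = (Abelianization.of g)⁻¹) : IsGroupIntegrable G := by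
  let H := G ⋊[(Subgroup.zpowers σ).subtype] (Subgroup.zpowers σ)
  have hrange : commutator H = (SemidirectProduct.inl : G →* H).range := by
    apply le_antisymm
    · rw [SemidirectProduct.range_inl_eq_ker_rightHom]
      rw [commutator_def, Subgroup.commutator_le]
      intro a _ b _
      rw [MonoidHom.mem_ker, map_commutatorElement, commutatorElement_eq_one_iff_mul_comm]
      exact (IsCyclic.isMulCommutative : IsMulCommutative (Subgroup.zpowers σ)).is_comm.comm _ _
    · rintro _ ⟨g, rfl⟩
      have hle : commutator G ≤ (commutator H).comap (SemidirectProduct.inl : G →* H) := by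
        rw [commutator_def, Subgroup.commutator_le]
        intro a _ b _
        rw [Subgroup.mem_comap, map_commutatorElement]
        exact Subgroup.commutator_mem_commutator (Subgroup.mem_top _) (Subgroup.mem_top _)
      have h1 : SemidirectProduct.inl (σ g * g) ∈ commutator H := hle (by
        rw [← Abelianization.ker_of, MonoidHom.mem_ker, map_mul, hσ, inv_mul_cancel])
      have h2 : SemidirectProduct.inl (σ g * g⁻¹) ∈ commutator H := by
        let s : Subgroup.zpowers σ := ⟨σ, Subgroup.mem_zpowers σ⟩
        have h3 := SemidirectProduct.inl_aut (φ := (Subgroup.zpowers σ).subtype) s g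
        have h4 : (SemidirectProduct.inl (σ g * g⁻¹) : H) =
            ⁅(SemidirectProduct.inr s : H), SemidirectProduct.inl g⁆ := by
          rw [commutatorElement_def, map_mul, map_inv, ← map_inv SemidirectProduct.inr]
          exact congr_arg (· * (SemidirectProduct.inl g)⁻¹) h3
        rw [h4]
        exact Subgroup.commutator_mem_commutator (Subgroup.mem_top _) (Subgroup.mem_top _)
      -- `(σ g * g⁻¹)⁻¹ * (σ g * g) = g ^ 2`; odd order then recovers `g` from its square.
      have h3 : SemidirectProduct.inl (g ^ 2) ∈ commutator H := by
        have := Subgroup.mul_mem _ (Subgroup.inv_mem _ h2) h1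
        rw [← map_inv, ← map_mul] at this
        convert this using 2
        simp [sq, mul_assoc]
      obtain ⟨m, hm⟩ := hG
      have h4 := Subgroup.pow_mem _ h3 (m + 1)
      rw [← map_pow, ← pow_mul, show 2 * (m + 1) = Nat.card G + 1 by omega, pow_succ,
        pow_card_eq_one', one_mul] at h4
      exact h4
  refine ⟨H, inferInstance, ⟨?_⟩⟩
  exact ((MulEquiv.subgroupCongr hrange).trans
    (MonoidHom.ofInjective SemidirectProduct.inl_injective).symm)

/-- The group of triples with `(a, x, i) (b, y, j) = (a b y ^ i, x y, i + j)`. -/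
@[ext]
structure ShearGroup (A : Type u) : Type u where
  fst : A
  snd : A
  exp : ℤ

namespace ShearGroup

variable {A : Type u} [CommGroup A]

instance : Mul (ShearGroup A) where
  mul g h := ⟨g.fst * h.fst * h.snd ^ g.exp, g.snd * h.snd, g.exp + h.exp⟩

instance : One (ShearGroup A) where
  one := ⟨1, 1, 0⟩

instance : Inv (ShearGroup A) where
  inv g := ⟨g.fst⁻¹ * g.snd ^ g.exp, g.snd⁻¹, -g.exp⟩

@[simp]
theorem fst_mul (g h : ShearGroup A) : (g * h).fst = g.fst * h.fst * h.snd ^ g.exp := rfl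

@[simp]
theorem snd_mul (g h : ShearGroup A) : (g * h).snd = g.snd * h.snd := rfl

@[simp]
theorem exp_mul (g h : ShearGroup A) : (g * h).exp = g.exp + h.exp := rfl

@[simp]
theorem fst_one : (1 : ShearGroup A).fst = 1 := rfl

@[simp]
theorem snd_one : (1 : ShearGroup A).snd = 1 := rfl

@[simp]
theorem exp_one : (1 : ShearGroup A).exp = 0 := rfl

@[simp]
theorem fst_inv (g : ShearGroup A) : g⁻¹.fst = g.fst⁻¹ * g.snd ^ g.exp := rfl

@[simp]
theorem snd_inv (g : ShearGroup A) : g⁻¹.snd = g.snd⁻¹ := rfl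

@[simp]
theorem exp_inv (g : ShearGroup A) : g⁻¹.exp = -g.exp := rfl

instance : Group (ShearGroup A) :=
  Group.ofLeftAxioms
    (fun a b c => by
      ext
      · simp only [fst_mul, snd_mul, exp_mul, mul_zpow, zpow_add]
        simp only [mul_assoc, mul_left_comm, mul_comm]
      · simp only [snd_mul, mul_assoc]
      · simp only [exp_mul, add_assoc])
    (fun a => by ext <;> simp)
    (fun a => by ext <;> simp)

/-- The central subgroup `A` of `ShearGroup A`. -/
def inl : A →* ShearGroup A where
  toFun a := ⟨a, 1, 0⟩
  map_one' := rfl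
  map_mul' a b := by ext <;> simp

/-- The quotient of `ShearGroup A` by its central subgroup `A`. -/
def proj : ShearGroup A →* A × Multiplicative ℤ where
  toFun g := (g.snd, Multiplicative.ofAdd g.exp)
  map_one' := rfl
  map_mul' _ _ := rfl

theorem commutator_eq : commutator (ShearGroup A) = (inl : A →* ShearGroup A).range := by
  apply le_antisymm
  · refine (Abelianization.commutator_subset_ker proj).trans fun g hg => ?_
    rw [MonoidHom.mem_ker, Prod.ext_iff] at hg
    exact ⟨g.fst, ShearGroup.ext rfl hg.1.symm hg.2.symm⟩
  · rintro _ ⟨a, rfl⟩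
    have h : inl a = ⁅(⟨1, 1, 1⟩ : ShearGroup A), ⟨1, a, 0⟩⁆ := by
      rw [commutatorElement_def]
      ext <;> simp [inl]
    rw [h]
    exact Subgroup.commutator_mem_commutator (Subgroup.mem_top _) (Subgroup.mem_top _)

theorem isGroupIntegrable : IsGroupIntegrable A :=
  ⟨ShearGroup A, inferInstance, ⟨(MulEquiv.subgroupCongr commutator_eq).trans
    (MonoidHom.ofInjective (f := (inl : A →* ShearGroup A))
      fun _ _ h => congr_arg fst h).symm⟩⟩

end ShearGroup

/-! ### The equivalence -/

theorem isGroupIntegrable_of_isIntegrableOrder {G : Type u} [Group G] [Finite G]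
    (hG : (Nat.card G).IsIntegrableOrder) : IsGroupIntegrable G := by
  rcases Nat.even_or_odd (Nat.card G) with h2 | h2
  · have hpow : Nat.card G = 2 ^ (Nat.card G).primeFactorsList.length := by
      refine Nat.eq_prime_pow_of_unique_prime_dvd Nat.card_pos.ne' fun {q} hq hqG => ?_
      by_contra hne
      have hodd := hq.eq_two_or_odd'.resolve_left hne
      exact hG.2 ⟨q, 2, hq, Nat.prime_two, hqG, h2.two_dvd, (Nat.Odd.sub_odd hodd odd_one).two_dvd⟩
    have hsq : Nat.card G ∣ 2 ^ 2 := by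
      rw [hpow]
      exact hG.1.pow_dvd_sq Nat.prime_two hpow.symm.dvd
    let _ : CommGroup G :=
      { (inferInstance : Group G) with mul_comm := commute_of_card_dvd_prime_sq hsq }
    exact ShearGroup.isGroupIntegrable
  · obtain ⟨σ, hσ⟩ := exists_inverting_abelianization hG
    exact isGroupIntegrable_of_odd_of_inverting h2 hσ

theorem exists_not_isGroupIntegrable {n : ℕ} (hn : n ≠ 0) (h : ¬ n.IsIntegrableOrder) :
    ∃ (G : Type u) (_ : Group G), Nat.card G = n ∧ ¬ IsGroupIntegrable G := by
  obtain ⟨G, _, hG, hH⟩ : ∃ (G : Type) (_ : Group G), Nat.card G = n ∧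
      ∀ (H : Type u) [Group H], ¬ IsGroupIntegral G H := by
    rw [Nat.IsIntegrableOrder, not_and_or, not_not, Nat.IsCubeFree] at h
    push Not at h
    rcases h with ⟨p, hp, hpn⟩ | ⟨p, q, hp, hq, hpn, hqn, hqp⟩
    · exact exists_card_eq_not_isGroupIntegral_of_cube_dvd hn hp hpn
    · exact exists_card_eq_not_isGroupIntegral_of_dvd_sub_one hn hp hq hpn hqn hqp
  -- The counterexample lives in `Type` but has no integral in `Type u`, so lifting it preserves
  -- non-integrability.
  refine ⟨ULift.{u} G, inferInstance, by rw [Nat.card_ulift, hG], ?_⟩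
  rintro ⟨H, _, ⟨e⟩⟩
  exact hH H ⟨e.trans MulEquiv.ulift⟩

theorem theoremt (n : ℕ) (hn : 0 < n) :
    (∀ (G : Type u) [Group G], Nat.card G = n → IsGroupIntegrable G) ↔
      (n.IsCubeFree ∧
        ¬ ∃ p q : ℕ, p.Prime ∧ q.Prime ∧ p ∣ n ∧ q ∣ n ∧ q ∣ p - 1) := by
  constructor
  · intro h
    by_contra hne
    obtain ⟨G, _, hG, hG'⟩ := exists_not_isGroupIntegrable.{u} hn.ne' hne
    exact hG' (h G hG)
  · intro h G _ hG
    have : Finite G := Nat.finite_of_card_ne_zero (hG ▸ hn.ne')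
    exact isGroupIntegrable_of_isIntegrableOrder (hG ▸ h)
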